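/- Let $r\ge 1$, let $s_1,\dots,s_r,t_1,\dots,t_r$ be positive integers and $n=\sum_{j=1}^r(s_j+t_j)$. Let $G$ be the threshold graph on the vertices $1,\dots,n$ with binary sequence $(b_1,\dots,b_n)=\mathbf 0^{s_1}\mathbf 1^{t_1}\cdots\mathbf 0^{s_r}\mathbf 1^{t_r}$ (blocks of $s_1$ zeros, $t_1$ ones, and so on); that is, for $i<j$ the vertices $i$ and $j$ are adjacent if and only if $b_j=1$. Call $G$ *simply structured* if $\mathbb R^n$ has a basis of eigenvectors of the Laplacian matrix of $G$ all of whose entries lie in $\{-1,0,1\}$. Then $G$ is simply structured if and only if all of the following hold: 1. $1\le r\le\left\lfloor\frac{\lfloor\log_2 n\rfloor+1}{2}\right\rfloor$; 2. for each $i=1,\dots,r$, $$\left\lceil\frac{n-\sum_{j=i+1}^r(s_j+t_j)}{2}\right\rceil\le t_i\le n-\sum_{j=i+1}^r(s_j+t_j)-2^{2i-2};$$ 3. for each $i=2,\dots,r$, $$\left\lceil\frac{n-t_i-\sum_{j=i+1}^r(s_j+t_j)}{2}\right\rceil\le s_i\le n-t_i-\sum_{j=i+1}^r(s_j+t_j)-2^{2i-3};$$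 4. $s_1=n-t_1-\sum_{j=2}^r(s_j+t_j)$. -/

import Mathlib

/-- The binary sequence `0^{s 1} 1^{t 1} ⋯ 0^{s r} 1^{t r}` (`false` is `0`, `true` is `1`). -/
def blockSequence (r : ℕ) (s t : ℕ → ℕ) : List Bool :=
  (List.range r).flatMap fun k =>
    List.replicate (s (k + 1)) false ++ List.replicate (t (k + 1)) true

/-- The threshold graph of a binary sequence `b` of length `n`: the vertices are added one after
the other, vertex `i` being joined to all earlier vertices if `b i = 1` and to none of them
if `b i = 0`. -/
def thresholdGraph {n : ℕ} (b : Fin n → Bool) : SimpleGraph (Fin n) where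
  Adj i j := (i < j ∧ b j = true) ∨ (j < i ∧ b i = true)
  symm := ⟨fun _ _ h => h.symm⟩
  loopless := ⟨fun i h => by rcases h with h | h <;> exact lt_irrefl i h.1⟩

instance thresholdGraph.decidableRelAdj {n : ℕ} (b : Fin n → Bool) :
    DecidableRel (thresholdGraph b).Adj := fun i j =>
  inferInstanceAs (Decidable ((i < j ∧ b j = true) ∨ (j < i ∧ b i = true)))

/-- A graph is simply structured if `ℝ^V` has a basis of eigenvectors of its Laplacian matrix all
of whose entries lie in `{-1, 0, 1}`. -/
def IsSimplyStructured {V : Type*} [Fintype V] [DecidableEq V] (G : SimpleGraph V)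
    [DecidableRel G.Adj] : Prop :=
  ∃ B : Module.Basis V ℝ (V → ℝ), ∀ k : V,
    (∃ μ : ℝ, Module.End.HasEigenvector (Matrix.toLin' (G.lapMatrix ℝ)) μ (B k)) ∧
      ∀ v : V, B k v ∈ ({-1, 0, 1} : Set ℝ)

/-! Balancing the first `i` vertices against vertex `i`, for `1 ≤ i < n`, and adding the constant
vector gives an orthogonal Laplacian eigenbasis. Two of these vertex eigenvalues agree only inside
one run of equal bits (`eq_of_vertexEigenvalue_eq`). So the eigenspace of a maximal run `[p, q]`
with `p ≥ 1` consists of vectors constant on `[0, p)`, zero after `q`, and of sum zero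
(`eigenvector_of_maximal_run`).

If the entries lie in `{-1, 0, 1}` and the constant is nonzero, the run must compensate a sum of
`±p`, so its length is at least `p`. A shorter run leaves part of its eigenspace unreached. If
instead every run after a change is as long as its prefix, differences of neighbours inside runs,
prefix-minus-equal-block vectors at the changes, and the constant vector form a basis
(`isSimplyStructured_thresholdGraph_iff`).

For block sequences the criterion says that each block is at least as long as all that precedes it:
these are the ceiling bounds. Prefix lengths then double at every block, which yields the powers of
two and the bound on `r`; condition 4 merely restates the value of `n`. -/

/-! ### Laplacian eigenvalues of threshold graphs -/

/-- The number of ones of `B` in the positions `k, …, n - 1`. -/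
def onesFrom (B : ℕ → Bool) (n k : ℕ) : ℝ :=
  ∑ l ∈ Finset.Ico k n, if B l then 1 else 0

/-- The Laplacian eigenvalue of the threshold graph of `B` attached to the vertex `k`. -/
def vertexEigenvalue (B : ℕ → Bool) (n k : ℕ) : ℝ :=
  (if B k then (k + 1 : ℝ) else 0) + onesFrom B n (k + 1)

theorem thresholdGraph_lapMatrix_mulVec {n : ℕ} (B : ℕ → Bool) (F : ℕ → ℝ) (v : Fin n) :
    ((thresholdGraph fun i : Fin n => B i).lapMatrix ℝ).mulVec (fun i => F i) v =
      ∑ w ∈ Finset.range n,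
        if ((v : ℕ) < w ∧ B w = true) ∨ (w < v ∧ B v = true) then F v - F w else 0 := by
  rw [SimpleGraph.lapMatrix_mulVec_apply, ← Fin.sum_univ_eq_sum_range
    (fun w => if ((v : ℕ) < w ∧ B w = true) ∨ (w < v ∧ B v = true) then F v - F w else 0),
    ← Finset.sum_filter, Finset.sum_sub_distrib, Finset.sum_const, nsmul_eq_mul,
    ← SimpleGraph.card_neighborFinset_eq_degree, SimpleGraph.neighborFinset_eq_filter]
  rfl

theorem onesFrom_split (B : ℕ → Bool) {n i k : ℕ} (hik : i ≤ k) (hk : k ≤ n) :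
    onesFrom B n i = (∑ l ∈ Finset.Ico i k, if B l then (1 : ℝ) else 0) + onesFrom B n k :=
  (Finset.sum_Ico_consecutive _ hik hk).symm

theorem onesFrom_nonneg (B : ℕ → Bool) (n k : ℕ) : 0 ≤ onesFrom B n k :=
  Finset.sum_nonneg fun l _ => by split <;> norm_num

/-- A vector that is constant before position `p`, vanishes from position `q` on and has sum zero
is a Laplacian eigenvector when the binary sequence is constant on `[p, q)`. -/
theorem thresholdGraph_lapMatrix_mulVec_of_run {n p q : ℕ} (B : ℕ → Bool) (F : ℕ → ℝ)
    (hq : q < n) (hconst : ∀ i < p, ∀ k < p, F i = F k)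
    (hsupp : ∀ i, q < i → F i = 0) (hsum : ∑ i ∈ Finset.range (q + 1), F i = 0)
    (hB : ∀ i, p ≤ i → i ≤ q → B i = B q) :
    ((thresholdGraph fun i : Fin n => B i).lapMatrix ℝ).mulVec (fun i => F i) =
      vertexEigenvalue B n q • (fun i : Fin n => F i) := by
  funext v
  rw [thresholdGraph_lapMatrix_mulVec, Pi.smul_apply, smul_eq_mul,
    ← Finset.sum_range_add_sum_Ico _ (Nat.succ_le_of_lt hq)]
  by_cases hv : (v : ℕ) ≤ q
  -- Two vertices before `p` contribute zero because `F` is constant there; in any other pair within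
  -- `[0, q]` the later vertex lies in the run, so adjacency is decided by `B q`.
  · have h1 : ∀ w ∈ Finset.range (q + 1),
        (if ((v : ℕ) < w ∧ B w = true) ∨ (w < v ∧ B v = true) then F v - F w else 0) =
          (if B q then F v - F w else 0) := by
      intro w hw
      rw [Finset.mem_range] at hw
      rcases lt_trichotomy (v : ℕ) w with h | h | h
      · by_cases hwp : w < p
        · rw [hconst v (by omega) w hwp]; simp
        · rw [hB w (by omega) (by omega)]
          simp [h, not_lt_of_gt h]
      · simp [h]
      · by_cases hvp : (v : ℕ) < p
        · rw [hconst v (by omega) w (by omega)]; simp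
        · rw [hB v (by omega) (by omega)]
          simp [h, not_lt_of_gt h]
    have h2 : ∀ w ∈ Finset.Ico (q + 1) n,
        (if ((v : ℕ) < w ∧ B w = true) ∨ (w < v ∧ B v = true) then F v - F w else 0) =
          (if B w then 1 else 0) * F v := by
      intro w hw
      rw [Finset.mem_Ico] at hw
      have h3 : (v : ℕ) < w := by omega
      rw [hsupp w (by omega)]
      simp [h3, not_lt_of_gt h3]
    rw [Finset.sum_congr rfl h1, Finset.sum_congr rfl h2, ← Finset.sum_mul, vertexEigenvalue,
      add_mul, onesFrom]
    congr 1
    split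
    · rw [Finset.sum_sub_distrib, hsum]; simp
    · simp
  · push Not at hv
    have h2 : ∀ w ∈ Finset.Ico (q + 1) n,
        (if ((v : ℕ) < w ∧ B w = true) ∨ (w < v ∧ B v = true) then F v - F w else 0) = 0 := by
      intro w hw
      rw [Finset.mem_Ico] at hw
      rw [hsupp w (by omega), hsupp v hv]
      simp
    have h1 : ∀ w ∈ Finset.range (q + 1),
        (if ((v : ℕ) < w ∧ B w = true) ∨ (w < v ∧ B v = true) then F v - F w else 0) =
          (if B v then - 1 else 0) * F w := by
      intro w hw
      rw [Finset.mem_range] at hw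
      have h3 : w < (v : ℕ) := by omega
      rw [hsupp v hv]
      simp [h3, not_lt_of_gt h3]
    rw [Finset.sum_congr rfl h1, Finset.sum_congr rfl h2, ← Finset.mul_sum, hsum, hsupp v hv]
    simp

/-- Vertices with the same eigenvalue lie in a common run of the binary sequence. -/
theorem eq_of_vertexEigenvalue_eq {B : ℕ → Bool} {n i k : ℕ} (hik : i < k) (hk : k < n)
    (h : vertexEigenvalue B n i = vertexEigenvalue B n k) :
    ∀ l, i ≤ l → l ≤ k → B l = B i := by
  have hsplit := onesFrom_split B (n := n) (i := i + 1) (k := k + 1) (by omega) (by omega)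
  have hT := onesFrom_nonneg B n (k + 1)
  have hik' : (i : ℝ) < k := by exact_mod_cast hik
  have hnn : ∀ l ∈ Finset.Ico (i + 1) (k + 1), (0 : ℝ) ≤ if B l then 1 else 0 :=
    fun l _ => by split <;> norm_num
  have hnn' : ∀ l ∈ Finset.Ico (i + 1) (k + 1), (0 : ℝ) ≤ 1 - if B l then 1 else 0 :=
    fun l _ => by split <;> norm_num
  have hS0 := Finset.sum_nonneg hnn
  have hS1 := Finset.sum_nonneg hnn'
  have hS : ∑ l ∈ Finset.Ico (i + 1) (k + 1), ((1 : ℝ) - if B l then 1 else 0) =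
      k - i - ∑ l ∈ Finset.Ico (i + 1) (k + 1), if B l then (1 : ℝ) else 0 := by
    rw [Finset.sum_sub_distrib]
    simp [Nat.cast_sub hik.le]
  unfold vertexEigenvalue at h
  have hi0 : (0 : ℝ) ≤ i := Nat.cast_nonneg i
  rcases hBi : B i <;> rcases hBk : B k <;> simp only [hBi, hBk, if_true, if_false,
    Bool.false_eq_true] at h
  · have h0 := (Finset.sum_eq_zero_iff_of_nonneg hnn).1 (by linarith)
    intro l hl hlk
    rcases hl.eq_or_lt with rfl | hl
    · exact hBi
    · simpa using h0 l (Finset.mem_Ico.2 ⟨hl, by omega⟩)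
  · linarith
  · linarith
  · have h0 := (Finset.sum_eq_zero_iff_of_nonneg hnn').1 (by linarith)
    intro l hl hlk
    rcases hl.eq_or_lt with rfl | hl
    · exact hBi
    · have := h0 l (Finset.mem_Ico.2 ⟨hl, by omega⟩)
      by_contra hb
      simp [hb] at this

/-- The final one dominates every vertex. Positivity makes the eigenvectors orthogonal to the
constants, which have eigenvalue `0`. -/
theorem vertexEigenvalue_pos {B : ℕ → Bool} {n k : ℕ} (hk : k < n) (hlast : B (n - 1) = true) :
    0 < vertexEigenvalue B n k := by
  unfold vertexEigenvalue
  have h0 := onesFrom_nonneg B n (k + 1)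
  rcases (Nat.succ_le_of_lt hk).eq_or_lt with h | h
  · have : B k = true := by rw [← hlast]; congr 1; omega
    rw [if_pos this]
    positivity
  · have h1 : 0 < onesFrom B n (k + 1) := by
      rw [onesFrom_split B (k := n - 1) (by omega) (by omega)]
      have h2 : onesFrom B n (n - 1) = 1 := by
        have : Finset.Ico (n - 1) n = {n - 1} := by ext; simp; omega
        rw [onesFrom, this, Finset.sum_singleton, hlast, if_pos rfl]
      have h3 : (0 : ℝ) ≤ ∑ l ∈ Finset.Ico (k + 1) (n - 1), if B l then (1 : ℝ) else 0 :=
        Finset.sum_nonneg fun l _ => by split <;> norm_num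
      linarith
    split <;> positivity

theorem dotProduct_eq_zero_of_mulVec_eq_smul {V : Type*} [Fintype V] {A : Matrix V V ℝ}
    (hA : A.IsSymm) {f g : V → ℝ} {μ ν : ℝ} (hf : A.mulVec f = μ • f) (hg : A.mulVec g = ν • g)
    (hμν : μ ≠ ν) : g ⬝ᵥ f = 0 := by
  have h1 : g ⬝ᵥ A.mulVec f = A.mulVec g ⬝ᵥ f := by
    rw [Matrix.dotProduct_mulVec, ← Matrix.mulVec_transpose, hA.eq]
  rw [hf, hg, dotProduct_smul, smul_dotProduct, smul_eq_mul, smul_eq_mul] at h1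
  have h2 : (μ - ν) * (g ⬝ᵥ f) = 0 := by linarith
  exact (mul_eq_zero.1 h2).resolve_left (sub_ne_zero.2 hμν)

/-! ### Eigenspaces of maximal runs -/

/-- The eigenvector attached to vertex `i`: each earlier vertex is balanced against `i`. -/
def vertexEigenvector (i l : ℕ) : ℝ :=
  if l < i then 1 else if l = i then -(i : ℝ) else 0

theorem sum_vertexEigenvector_mul {n i : ℕ} (hi : i < n) (F : ℕ → ℝ) :
    ∑ l ∈ Finset.range n, vertexEigenvector i l * F l =
      ∑ l ∈ Finset.range i, F l - i * F i := by
  have h0 : ∀ l ∈ Finset.Ico (i + 1) n, vertexEigenvector i l * F l = 0 := by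
    intro l hl
    rw [Finset.mem_Ico] at hl
    rw [vertexEigenvector, if_neg (by omega), if_neg (by omega), zero_mul]
  have h1 : ∀ l ∈ Finset.range i, vertexEigenvector i l * F l = F l := by
    intro l hl
    rw [vertexEigenvector, if_pos (Finset.mem_range.1 hl), one_mul]
  rw [← Finset.sum_range_add_sum_Ico _ (Nat.succ_le_of_lt hi), Finset.sum_eq_zero h0,
    Finset.sum_range_succ, Finset.sum_congr rfl h1, vertexEigenvector, if_neg (lt_irrefl i),
    if_pos rfl]
  ring

theorem lapMatrix_mulVec_vertexEigenvector {n i : ℕ} (B : ℕ → Bool) (hi : i < n) :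
    ((thresholdGraph fun i : Fin n => B i).lapMatrix ℝ).mulVec
        (fun l : Fin n => vertexEigenvector i l) =
      vertexEigenvalue B n i • (fun l : Fin n => vertexEigenvector i l) := by
  refine thresholdGraph_lapMatrix_mulVec_of_run (p := i) B _ hi ?_ ?_ ?_ ?_
  · intro a ha c hc
    simp [vertexEigenvector, ha, hc]
  · intro l hl
    rw [vertexEigenvector, if_neg (by omega), if_neg (by omega)]
  · have := sum_vertexEigenvector_mul (Nat.lt_succ_self i) (fun _ => 1)
    simpa using this
  · intro l h1 h2
    rw [le_antisymm h2 h1]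

/-- The eigenvectors of the eigenvalue of a maximal run `[p, q]` are constant before the run,
vanish after it, and have sum zero. -/
theorem eigenvector_of_maximal_run {n p q : ℕ} {B : ℕ → Bool} {F : ℕ → ℝ} (hp : 1 ≤ p)
    (hpq : p ≤ q) (hq : q < n) (hlast : B (n - 1) = true) (hleft : B (p - 1) ≠ B p)
    (hright : q + 1 < n → B (q + 1) ≠ B q)
    (hF : ((thresholdGraph fun i : Fin n => B i).lapMatrix ℝ).mulVec (fun i => F i) =
      vertexEigenvalue B n q • (fun i : Fin n => F i)) :
    (∀ i < p, F i = F 0) ∧ (∀ i, q < i → i < n → F i = 0) ∧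
      ∑ i ∈ Finset.range (q + 1), F i = 0 := by
  have hsymm := (thresholdGraph fun i : Fin n => B i).isSymm_lapMatrix (R := ℝ)
  have htotal : ∑ i ∈ Finset.range n, F i = 0 := by
    have h := dotProduct_eq_zero_of_mulVec_eq_smul hsymm (g := fun _ => 1) (ν := 0) hF
      (by rw [zero_smul]; exact SimpleGraph.lapMatrix_mulVec_const_eq_zero _)
      (vertexEigenvalue_pos hq hlast).ne'
    rw [← Fin.sum_univ_eq_sum_range]
    simpa [dotProduct] using h
  -- By maximality, vertices outside the run have other eigenvalues. Orthogonality to their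
  -- eigenvectors makes `F i` the mean of the earlier values.
  have horth : ∀ i, i < n → (i < p ∨ q < i) →
      ∑ l ∈ Finset.range i, F l = i * F i := by
    intro i hi hipq
    have hne : vertexEigenvalue B n q ≠ vertexEigenvalue B n i := by
      rcases hipq with h | h
      · intro he
        have h1 := eq_of_vertexEigenvalue_eq (by omega) hq he.symm
        exact hleft ((h1 (p - 1) (by omega) (by omega)).trans (h1 p h.le hpq).symm)
      · intro he
        exact hright (by omega)
          (eq_of_vertexEigenvalue_eq h hi he (q + 1) (by omega) (by omega))
    have h := dotProduct_eq_zero_of_mulVec_eq_smul hsymm hF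
      (lapMatrix_mulVec_vertexEigenvector B hi) hne
    rw [dotProduct, Fin.sum_univ_eq_sum_range (fun l => vertexEigenvector i l * F l),
      sum_vertexEigenvector_mul hi] at h
    linarith
  have hconst : ∀ i < p, F i = F 0 := by
    intro i
    induction i using Nat.strong_induction_on with
    | _ i ih =>
      intro hip
      rcases Nat.eq_zero_or_pos i with rfl | hi
      · rfl
      · have h := horth i (by omega) (Or.inl hip)
        rw [Finset.sum_congr rfl fun l hl => ih l (Finset.mem_range.1 hl)
          ((Finset.mem_range.1 hl).trans hip), Finset.sum_const, Finset.card_range,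
          nsmul_eq_mul] at h
        exact (mul_left_cancel₀ (by positivity) h).symm
  have hstep : ∀ i, q < i → i < n → ∑ l ∈ Finset.range (i + 1), F l = 0 → F i = 0 := by
    intro i hqi hi h0
    rw [Finset.sum_range_succ, horth i hi (Or.inr hqi)] at h0
    have h1 : ((i : ℝ) + 1) * F i = 0 := by linarith
    exact (mul_eq_zero.1 h1).resolve_left (by positivity)
  -- Downward induction from the total sum: a zero sum up to `i` included, with `F i` the mean of
  -- the earlier values, forces `F i = 0`.
  have hpartial : ∀ d i, i + d = n → q < i → ∑ l ∈ Finset.range i, F l = 0 := by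
    intro d
    induction d with
    | zero => rintro i rfl _; exact htotal
    | succ d ih =>
      intro i hi hqi
      have h := ih (i + 1) (by omega) (by omega)
      rw [horth i (by omega) (Or.inr hqi), hstep i hqi (by omega) h, mul_zero]
  exact ⟨hconst, fun i hqi hi => hstep i hqi hi (hpartial (n - (i + 1)) _ (by omega) (by omega)),
    hpartial (n - (q + 1)) _ (by omega) (by omega)⟩

/-! ### The run-length criterion -/

/-- In a simply structured threshold graph a maximal run is at least as long as the sequence
before it. -/
theorem IsSimplyStructured.two_mul_le_of_maximal_run {n p q : ℕ} {B : ℕ → Bool}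
    (h : IsSimplyStructured (thresholdGraph fun i : Fin n => B i)) (hp : 1 ≤ p)
    (hpq : p ≤ q) (hq : q < n) (hlast : B (n - 1) = true) (hleft : B (p - 1) ≠ B p)
    (hright : q + 1 < n → B (q + 1) ≠ B q) (hB : ∀ i, p ≤ i → i ≤ q → B i = B q) :
    2 * p ≤ q + 1 := by
  by_contra! hlt
  obtain ⟨b, hb⟩ := h
  -- This is the direction in the eigenspace orthogonal to every sum-zero vector supported on the
  -- run. For a short run, all basis vectors turn out orthogonal to it.
  set w : ℕ → ℝ := fun l =>
    if l < p then ((q : ℝ) + 1 - p) else if l ≤ q then -(p : ℝ) else 0 with hw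
  have hsum : ∀ G : ℕ → ℝ, ∑ l ∈ Finset.range n, w l * G l =
      (q + 1 - p) * ∑ l ∈ Finset.range p, G l - p * ∑ l ∈ Finset.Ico p (q + 1), G l := by
    intro G
    rw [← Finset.sum_range_add_sum_Ico _ (Nat.succ_le_of_lt hq),
      ← Finset.sum_range_add_sum_Ico _ (show p ≤ q.succ by omega), Finset.mul_sum,
      Finset.mul_sum, sub_eq_add_neg, ← Finset.sum_neg_distrib]
    have h0 : ∑ l ∈ Finset.Ico q.succ n, w l * G l = 0 := by
      refine Finset.sum_eq_zero fun l hl => ?_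
      rw [Finset.mem_Ico] at hl
      simp only [hw]
      rw [if_neg (by omega), if_neg (by omega), zero_mul]
    rw [h0, add_zero]
    congr 1
    · refine Finset.sum_congr rfl fun l hl => ?_
      simp only [hw]
      rw [if_pos (Finset.mem_range.1 hl)]
    · refine Finset.sum_congr rfl fun l hl => ?_
      rw [Finset.mem_Ico] at hl
      simp only [hw]
      rw [if_neg (by omega), if_pos (by omega), neg_mul]
  have hweig : ((thresholdGraph fun i : Fin n => B i).lapMatrix ℝ).mulVec (fun i => w i) =
      vertexEigenvalue B n q • (fun i : Fin n => w i) := by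
    refine thresholdGraph_lapMatrix_mulVec_of_run (p := p) B _ hq ?_ ?_ ?_ hB
    · intro a ha c hc
      simp [hw, ha, hc]
    · intro l hl
      simp only [hw]
      rw [if_neg (by omega), if_neg (by omega)]
    · have h1 := hsum fun _ => 1
      rw [← Finset.sum_range_add_sum_Ico _ (Nat.succ_le_of_lt hq)] at h1
      have h0 : ∑ l ∈ Finset.Ico q.succ n, w l * 1 = 0 := by
        refine Finset.sum_eq_zero fun l hl => ?_
        rw [Finset.mem_Ico] at hl
        simp only [hw]
        rw [if_neg (by omega), if_neg (by omega), zero_mul]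
      rw [h0] at h1
      simp only [mul_one, add_zero, Finset.sum_const, Finset.card_range, Nat.card_Ico,
        nsmul_eq_mul] at h1
      rw [Nat.cast_sub (by omega)] at h1
      rw [h1]
      push_cast
      ring
  have horth : ∀ k, (fun i : Fin n => w i) ⬝ᵥ b k = 0 := by
    intro k
    obtain ⟨⟨μ, hμ⟩, hval⟩ := hb k
    have hμ' : ((thresholdGraph fun i : Fin n => B i).lapMatrix ℝ).mulVec (b k) = μ • b k := by
      simpa using hμ.apply_eq_smul
    by_cases hμq : μ = vertexEigenvalue B n q
    · subst hμq
      set F : ℕ → ℝ := fun l => if hl : l < n then b k ⟨l, hl⟩ else 0 with hFdef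
      have hFb : b k = fun i : Fin n => F i := by
        funext i; simp [hFdef]
      have hFval : ∀ l, |F l| ≤ 1 ∧ (F l = 0 ∨ |F l| = 1) := by
        intro l
        by_cases hl : l < n
        · simp only [hFdef, dif_pos hl]
          have h1 := hval ⟨l, hl⟩
          simp only [Set.mem_insert_iff, Set.mem_singleton_iff] at h1
          rcases h1 with h1 | h1 | h1 <;> rw [h1] <;> simp
        · simp [hFdef, hl]
      rw [hFb] at hμ' ⊢
      obtain ⟨h1, -, h3⟩ := eigenvector_of_maximal_run hp hpq hq hlast hleft hright hμ'
      rw [← Finset.sum_range_add_sum_Ico _ (show p ≤ q + 1 by omega)] at h3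
      have h4 : ∑ l ∈ Finset.range p, F l = p * F 0 := by
        rw [Finset.sum_congr rfl fun l hl => h1 l (Finset.mem_range.1 hl)]
        simp
      have h5 : |∑ l ∈ Finset.Ico p (q + 1), F l| ≤ q + 1 - p := by
        refine (Finset.abs_sum_le_sum_abs _ _).trans
          ((Finset.sum_le_sum fun l _ => (hFval l).1).trans ?_)
        simp [Nat.cast_sub (show p ≤ q + 1 by omega)]
      -- If `|F 0| = 1`, the run would have to sum to `±p` with fewer than `p` entries of modulus at
      -- most one.
      have h6 : F 0 = 0 := by
        refine (hFval 0).2.resolve_right fun h7 => ?_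
        have h8 : ∑ l ∈ Finset.Ico p (q + 1), F l = -(p * F 0) := by linarith
        rw [h8, abs_neg, abs_mul, h7, mul_one, Nat.abs_cast] at h5
        have h9 : ((q + 1 : ℕ) : ℝ) < ((2 * p : ℕ) : ℝ) := by exact_mod_cast hlt
        push_cast at h9
        linarith
      rw [dotProduct, Fin.sum_univ_eq_sum_range (fun l => w l * F l), hsum]
      rw [h4, h6, mul_zero, zero_add] at h3
      rw [h4, h3, h6]
      ring
    · exact dotProduct_eq_zero_of_mulVec_eq_smul (SimpleGraph.isSymm_lapMatrix ℝ _) hμ' hweig hμq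
  have hzero : (fun i : Fin n => w i) = 0 := by
    rw [← dotProduct_self_eq_zero]
    have h1 : ∀ x : Fin n → ℝ, (fun i : Fin n => w i) ⬝ᵥ x = 0 := by
      intro x
      rw [← b.sum_repr x, dotProduct_sum]
      exact Finset.sum_eq_zero fun k _ => by rw [dotProduct_smul, horth k, smul_zero]
    exact h1 _
  have h0 := congrFun hzero ⟨q, hq⟩
  simp only [hw, Pi.zero_apply] at h0
  rw [if_neg (by omega), if_pos le_rfl, neg_eq_zero] at h0
  have : p = 0 := by exact_mod_cast h0
  omega

/-- A threshold graph whose sequence ends in a one is simply structured iff every run that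
follows a change in the sequence is at least as long as the sequence before it. -/
theorem isSimplyStructured_thresholdGraph_iff {n : ℕ} {B : ℕ → Bool}
    (hlast : B (n - 1) = true) :
    IsSimplyStructured (thresholdGraph fun i : Fin n => B i) ↔
      ∀ j, 1 ≤ j → j < n → B (j - 1) ≠ B j →
        2 * j ≤ n ∧ ∀ k, j ≤ k → k < 2 * j → B k = B j := by
  constructor
  · intro h j hj hjn hchange
    -- The least such `q` is the end of the run starting at `j`; the witness `n` satisfies the
    -- implication vacuously.
    have hex : ∃ q, j ≤ q ∧ (q + 1 < n → B (q + 1) ≠ B j) := ⟨n, by omega, by omega⟩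
    classical
    set q := Nat.find hex with hqdef
    obtain ⟨hjq, hq1⟩ := Nat.find_spec hex
    have hmin : ∀ m < q, j ≤ m → m + 1 < n ∧ B (m + 1) = B j := by
      intro m hm hjm
      have := Nat.find_min hex hm
      push Not at this
      exact this hjm
    have hconst : ∀ i, j ≤ i → i ≤ q → B i = B j := by
      intro i hji hiq
      rcases hji.eq_or_lt with rfl | hlt
      · rfl
      · have := (hmin (i - 1) (by omega) (by omega)).2
        rwa [Nat.sub_add_cancel (by omega)] at this
    have hqn : q < n := by
      rcases hjq.eq_or_lt with h1 | h1
      · omega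
      · have := (hmin (q - 1) (by omega) (by omega)).1
        omega
    have h2 := h.two_mul_le_of_maximal_run hj hjq hqn hlast hchange
      (fun h3 => by rw [hconst q hjq le_rfl]; exact hq1 h3)
      (fun i h3 h4 => (hconst i h3 h4).trans (hconst q hjq le_rfl).symm)
    exact ⟨by omega, fun k h3 h4 => hconst k h3 (by omega)⟩
  · intro h
    set v : ℕ → ℕ → ℝ := fun j l =>
      if j = 0 then 1
      else if B (j - 1) = B j then (if l + 1 = j then 1 else if l = j then -1 else 0)
      else if l < j then 1 else if l < 2 * j then -1 else 0 with hv
    have hvval : ∀ j l, v j l ∈ ({-1, 0, 1} : Set ℝ) := by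
      intro j l
      simp only [hv]
      split_ifs <;> simp
    have hpair : ∀ j, 1 ≤ j → j < n → B (j - 1) = B j → ∀ F : ℕ → ℝ, ∀ m, j < m →
        ∑ l ∈ Finset.range m, v j l * F l = F (j - 1) - F j := by
      intro j hj hjn hBj F m hm
      have h1 : ∀ l ∈ Finset.range m, v j l * F l =
          (if l = j - 1 then F (j - 1) else 0) - (if l = j then F j else 0) := by
        intro l _
        simp only [hv, if_neg (show j ≠ 0 by omega), if_pos hBj]
        by_cases h2 : l = j - 1
        · rw [if_pos (by omega), if_pos h2, if_neg (by omega), h2]; ring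
        · rw [if_neg (by omega), if_neg h2]
          by_cases h3 : l = j
          · rw [if_pos h3, if_pos h3, h3]; ring
          · rw [if_neg h3, if_neg h3]; ring
      rw [Finset.sum_congr rfl h1, Finset.sum_sub_distrib, Finset.sum_ite_eq', Finset.sum_ite_eq',
        if_pos (Finset.mem_range.2 (by omega)), if_pos (Finset.mem_range.2 hm)]
    have hblock : ∀ j, 1 ≤ j → B (j - 1) ≠ B j → ∀ F : ℕ → ℝ, ∀ m, 2 * j ≤ m →
        ∑ l ∈ Finset.range m, v j l * F l =
          ∑ l ∈ Finset.range j, F l - ∑ l ∈ Finset.Ico j (2 * j), F l := by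
      intro j hj hBj F m hm
      rw [← Finset.sum_range_add_sum_Ico _ hm,
        ← Finset.sum_range_add_sum_Ico _ (show j ≤ 2 * j by omega), sub_eq_add_neg,
        ← Finset.sum_neg_distrib]
      have h0 : ∑ l ∈ Finset.Ico (2 * j) m, v j l * F l = 0 := by
        refine Finset.sum_eq_zero fun l hl => ?_
        rw [Finset.mem_Ico] at hl
        simp only [hv, if_neg (show j ≠ 0 by omega), if_neg hBj]
        rw [if_neg (by omega), if_neg (by omega), zero_mul]
      rw [h0, add_zero]
      congr 1
      · refine Finset.sum_congr rfl fun l hl => ?_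
        simp only [hv, if_neg (show j ≠ 0 by omega), if_neg hBj]
        rw [if_pos (Finset.mem_range.1 hl), one_mul]
      · refine Finset.sum_congr rfl fun l hl => ?_
        rw [Finset.mem_Ico] at hl
        simp only [hv, if_neg (show j ≠ 0 by omega), if_neg hBj]
        rw [if_neg (by omega), if_pos (by omega), neg_one_mul]
    have heig : ∀ j < n, ∃ μ : ℝ,
        ((thresholdGraph fun i : Fin n => B i).lapMatrix ℝ).mulVec (fun i => v j i) =
          μ • (fun i : Fin n => v j i) := by
      intro j hjn
      rcases Nat.eq_zero_or_pos j with rfl | hj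
      · refine ⟨0, ?_⟩
        simp only [hv, if_true, zero_smul]
        exact SimpleGraph.lapMatrix_mulVec_const_eq_zero _
      by_cases hBj : B (j - 1) = B j
      · refine ⟨vertexEigenvalue B n j, thresholdGraph_lapMatrix_mulVec_of_run (p := j - 1) B _
          hjn ?_ ?_ ?_ ?_⟩
        · intro a ha c hc
          simp only [hv, if_neg (show j ≠ 0 by omega), if_pos hBj]
          rw [if_neg (by omega), if_neg (by omega), if_neg (by omega), if_neg (by omega)]
        · intro l hl
          simp only [hv, if_neg (show j ≠ 0 by omega), if_pos hBj]
          rw [if_neg (by omega), if_neg (by omega)]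
        · simpa using hpair j hj hjn hBj (fun _ => 1) (j + 1) (by omega)
        · intro l h1 h2
          rcases h2.eq_or_lt with rfl | h3
          · rfl
          · rw [← hBj]; congr 1; omega
      · obtain ⟨h1, h2⟩ := h j hj hjn hBj
        -- The run may continue beyond `2 * j - 1`; the run lemma does not require maximality.
        refine ⟨vertexEigenvalue B n (2 * j - 1), thresholdGraph_lapMatrix_mulVec_of_run (p := j)
          B _ (by omega) ?_ ?_ ?_ ?_⟩
        · intro a ha c hc
          simp [hv, ha, hc, hBj]
        · intro l hl
          simp only [hv, if_neg (show j ≠ 0 by omega), if_neg hBj]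
          rw [if_neg (by omega), if_neg (by omega)]
        · rw [Nat.sub_add_cancel (by omega)]
          have h3 := hblock j hj hBj (fun _ => 1) (2 * j) le_rfl
          simp only [mul_one] at h3
          rw [h3]
          simp [two_mul]
        · intro l h3 h4
          rw [h2 l h3 (by omega), h2 (2 * j - 1) (by omega) (by omega)]
    set M : Matrix (Fin n) (Fin n) ℝ := fun j l => v j l with hM
    have hinj : Function.Injective M.mulVec := by
      -- Orthogonality to the rows `j ≥ 1` makes `x` constant, by induction on the index; row `0`,
      -- of all ones, then makes it zero.
      have hker : ∀ x : Fin n → ℝ, M.mulVec x = 0 → x = 0 := by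
        intro x hx
        set F : ℕ → ℝ := fun l => if hl : l < n then x ⟨l, hl⟩ else 0 with hFdef
        have hFx : x = fun i : Fin n => F i := by
          funext i; simp [hFdef]
        have hrow : ∀ j < n, ∑ l ∈ Finset.range n, v j l * F l = 0 := by
          intro j hj
          rw [← Fin.sum_univ_eq_sum_range (fun l => v j l * F l)]
          rw [hFx] at hx
          exact congrFun hx ⟨j, hj⟩
        have hFc : ∀ j < n, F j = F 0 := by
          intro j
          induction j using Nat.strong_induction_on with
          | _ j ih =>
            intro hjn
            rcases Nat.eq_zero_or_pos j with rfl | hj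
            · rfl
            have hr := hrow j hjn
            by_cases hBj : B (j - 1) = B j
            · rw [hpair j hj hjn hBj F n hjn, ih (j - 1) (by omega) (by omega)] at hr
              linarith
            · obtain ⟨h1, h2⟩ := h j hj hjn hBj
              -- The neighbour differences make `F` constant on `[j, 2 * j)`, so the row at the
              -- change `j` compares this value with the one on the prefix.
              have hc : ∀ k, j ≤ k → k < 2 * j → F k = F j := by
                intro k hjk
                induction k, hjk using Nat.le_induction with
                | base => intro _; rfl
                | succ k hjk ihk =>
                  intro hk
                  have hBk : B (k + 1 - 1) = B (k + 1) := by
                    rw [h2 (k + 1) (by omega) hk, Nat.add_sub_cancel, h2 k hjk (by omega)]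
                  have hr' := hrow (k + 1) (by omega)
                  rw [hpair (k + 1) (by omega) (by omega) hBk F n (by omega),
                    Nat.add_sub_cancel, ihk (by omega)] at hr'
                  linarith
              rw [hblock j hj hBj F n h1, Finset.sum_congr rfl fun l hl =>
                ih l (Finset.mem_range.1 hl) ((Finset.mem_range.1 hl).trans hjn),
                Finset.sum_congr rfl fun l hl => hc l (Finset.mem_Ico.1 hl).1
                  (Finset.mem_Ico.1 hl).2] at hr
              simp only [Finset.sum_const, Finset.card_range, Nat.card_Ico, nsmul_eq_mul,
                two_mul, Nat.add_sub_cancel] at hr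
              have hj' : (j : ℝ) ≠ 0 := by positivity
              have h3 : (j : ℝ) * F j = j * F 0 := by linarith
              exact mul_left_cancel₀ hj' h3
        funext i
        have hn : 0 < n := i.pos
        have h0 := hrow 0 hn
        rw [Finset.sum_congr rfl fun l hl => by rw [hFc l (Finset.mem_range.1 hl)]] at h0
        simp only [hv, if_true, one_mul, Finset.sum_const, Finset.card_range, nsmul_eq_mul] at h0
        have hn' : (n : ℝ) ≠ 0 := by positivity
        rw [hFx]
        simp only [hFc i i.2, Pi.zero_apply]
        exact (mul_eq_zero.1 h0).resolve_left hn'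
      intro x y hxy
      rw [← sub_eq_zero]
      refine hker _ ?_
      rw [Matrix.mulVec_sub]
      exact sub_eq_zero.2 hxy
    have hli : LinearIndependent ℝ M.row :=
      Matrix.linearIndependent_rows_iff_isUnit.2 (Matrix.mulVec_injective_iff_isUnit.1 hinj)
    refine ⟨Module.Basis.mk hli ?_, fun k => ?_⟩
    · rw [hli.span_eq_top_of_card_eq_finrank' (by simp)]
    · rw [Module.Basis.mk_apply]
      obtain ⟨μ, hμ⟩ := heig k k.2
      refine ⟨⟨μ, Module.End.mem_eigenspace_iff.2 ?_, hli.ne_zero k⟩, fun l => hvval k l⟩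
      rw [Matrix.toLin'_apply]
      exact hμ

/-! ### Arithmetic of block sequences -/

/-- The number of vertices of the first `k` pairs of blocks. -/
def blockLength (s t : ℕ → ℕ) (k : ℕ) : ℕ :=
  ∑ j ∈ Finset.range k, (s (j + 1) + t (j + 1))

theorem blockLength_succ (s t : ℕ → ℕ) (k : ℕ) :
    blockLength s t (k + 1) = blockLength s t k + (s (k + 1) + t (k + 1)) :=
  Finset.sum_range_succ _ _

theorem blockLength_mono (s t : ℕ → ℕ) : Monotone (blockLength s t) :=
  monotone_nat_of_le_succ fun k => by rw [blockLength_succ]; omega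

theorem blockSequence_succ (r : ℕ) (s t : ℕ → ℕ) :
    blockSequence (r + 1) s t = blockSequence r s t ++
      (List.replicate (s (r + 1)) false ++ List.replicate (t (r + 1)) true) := by
  simp [blockSequence, List.range_succ]

theorem length_blockSequence (r : ℕ) (s t : ℕ → ℕ) :
    (blockSequence r s t).length = blockLength s t r := by
  induction r with
  | zero => rfl
  | succ r ih => simp [blockSequence_succ, blockLength_succ, ih]

theorem blockSequence_getD (r : ℕ) (s t : ℕ → ℕ) {k x : ℕ} (hk : k < r)
    (hx : blockLength s t k ≤ x) (hx' : x < blockLength s t (k + 1)) :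
    (blockSequence r s t).getD x false = decide (blockLength s t k + s (k + 1) ≤ x) := by
  induction r with
  | zero => omega
  | succ r ih =>
    rw [blockSequence_succ]
    rcases (Nat.lt_succ_iff.1 hk).lt_or_eq with h | rfl
    · have hlt : x < (blockSequence r s t).length := by
        rw [length_blockSequence]
        exact hx'.trans_le (blockLength_mono s t h)
      rw [List.getD_append _ _ _ _ hlt, ih h]
    · rw [blockLength_succ] at hx'
      rw [List.getD_append_right _ _ _ _ (by rwa [length_blockSequence]), length_blockSequence]
      by_cases hs : blockLength s t k + s (k + 1) ≤ x
      · rw [List.getD_append_right _ _ _ _ (by rw [List.length_replicate]; omega),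
          List.length_replicate, List.getD_replicate _ (by omega)]
        simp [hs]
      · rw [List.getD_append _ _ _ _ (by rw [List.length_replicate]; omega),
          List.getD_replicate _ (by omega)]
        simp [hs]

theorem exists_blockLength_le_lt (s t : ℕ → ℕ) {r x : ℕ} (hx : x < blockLength s t r) :
    ∃ k < r, blockLength s t k ≤ x ∧ x < blockLength s t (k + 1) := by
  induction r with
  | zero => simp [blockLength] at hx
  | succ r ih =>
    by_cases h : x < blockLength s t r
    · obtain ⟨k, hk, h1⟩ := ih h
      exact ⟨k, by omega, h1⟩
    · exact ⟨r, by omega, by omega, hx⟩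

/-- For a block sequence, every run after a change is at least as long as what precedes it iff
every block satisfies the corresponding inequality. -/
theorem runs_long_iff_blocks_long {r : ℕ} {s t : ℕ → ℕ} (hs : ∀ k < r, 0 < s (k + 1))
    (ht : ∀ k < r, 0 < t (k + 1)) :
    (∀ j, 1 ≤ j → j < blockLength s t r →
      (blockSequence r s t).getD (j - 1) false ≠ (blockSequence r s t).getD j false →
        2 * j ≤ blockLength s t r ∧ ∀ k, j ≤ k → k < 2 * j →
          (blockSequence r s t).getD k false = (blockSequence r s t).getD j false) ↔
    ∀ k < r, blockLength s t k + s (k + 1) ≤ t (k + 1) ∧ blockLength s t k ≤ s (k + 1) := by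
  set N := blockLength s t with hN
  have hsucc : ∀ k, N (k + 1) = N k + (s (k + 1) + t (k + 1)) := blockLength_succ s t
  have hmono : Monotone N := blockLength_mono s t
  have hget : ∀ {k x : ℕ}, k < r → N k ≤ x → x < N (k + 1) →
      (blockSequence r s t).getD x false = decide (N k + s (k + 1) ≤ x) :=
    fun hk h1 h2 => blockSequence_getD r s t hk h1 h2
  constructor
  · intro h k hk
    have hsk := hs k hk
    have htk := ht k hk
    have hk1 := hsucc k
    have hkr : N (k + 1) ≤ N r := hmono (by omega)
    constructor
    · have h0 := hget (x := N k + s (k + 1) - 1) hk (by omega) (by omega)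
      have h1 := hget (x := N k + s (k + 1)) hk (by omega) (by omega)
      rw [decide_eq_false (by omega)] at h0
      rw [decide_eq_true (by omega)] at h1
      obtain ⟨h2, h3⟩ := h (N k + s (k + 1)) (by omega) (by omega) (by rw [h0, h1]; decide)
      -- A short block of ones is followed by a zero before position `2 * j`, or, if it is the last
      -- block, `2 * j` exceeds the total length.
      by_contra! hlt
      have hkr' : k + 1 < r := by
        by_contra hcon
        rw [show r = k + 1 by omega] at h2
        omega
      have hs' := hs (k + 1) hkr'
      have hk2 := hsucc (k + 1)
      have h4 := h3 (N (k + 1)) (by omega) (by omega)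
      rw [h1, hget hkr' le_rfl (by omega), decide_eq_false (by omega)] at h4
      exact absurd h4 (by decide)
    · rcases Nat.eq_zero_or_pos k with rfl | hkpos
      · simp [hN, blockLength]
      obtain ⟨m, rfl⟩ : ∃ m, k = m + 1 := ⟨k - 1, by omega⟩
      have htm := ht m (by omega)
      have hm1 := hsucc m
      have h0 := hget (k := m) (x := N (m + 1) - 1) (by omega) (by omega) (by omega)
      have h1 := hget (x := N (m + 1)) hk (by omega) (by omega)
      rw [decide_eq_true (by omega)] at h0
      rw [decide_eq_false (by omega)] at h1
      obtain ⟨-, h3⟩ := h (N (m + 1)) (by omega) (by omega) (by rw [h0, h1]; decide)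
      by_contra! hlt
      have h4 := h3 (N (m + 1) + s (m + 1 + 1)) (by omega) (by omega)
      rw [h1, hget hk (by omega) (by omega), decide_eq_true (by omega)] at h4
      exact absurd h4 (by decide)
  · intro h j hj hjn hne
    obtain ⟨k, hk, hkj, hjk⟩ := exists_blockLength_le_lt s t hjn
    rw [← hN] at hkj hjk
    obtain ⟨h1, h2⟩ := h k hk
    have hk1 := hsucc k
    have hkr : N (k + 1) ≤ N r := hmono (by omega)
    -- Within a pair of blocks the bit changes only at the start of the zeros or of the ones.
    rcases hkj.eq_or_lt with rfl | hlt
    · refine ⟨by omega, fun i hi hi' => ?_⟩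
      rw [hget hk hi (by omega), hget hk le_rfl hjk, decide_eq_false (by omega),
        decide_eq_false (by omega)]
    · rw [hget hk hkj hjk, hget hk (by omega) (by omega)] at hne
      have hj' : j = N k + s (k + 1) := by
        by_contra hcon
        apply hne
        congr 1
        rw [eq_iff_iff]
        omega
      refine ⟨by omega, fun i hi hi' => ?_⟩
      rw [hget hk (by omega) (by omega), hget hk hkj hjk, decide_eq_true (by omega),
        decide_eq_true (by omega)]

theorem blockLength_add_sum_Icc (s t : ℕ → ℕ) {i r : ℕ} (hir : i ≤ r) :
    blockLength s t i + ∑ j ∈ Finset.Icc (i + 1) r, (s j + t j) = blockLength s t r := by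
  induction r, hir using Nat.le_induction with
  | base => simp
  | succ r hir ih =>
    rw [Finset.sum_Icc_succ_top (by omega), ← add_assoc, ih, blockLength_succ]

/-- If every block is at least as long as what precedes it, the lengths at least double. -/
theorem two_pow_le_blockLength {r : ℕ} {s t : ℕ → ℕ} (hs : ∀ k < r, 0 < s (k + 1))
    (h : ∀ k < r, blockLength s t k + s (k + 1) ≤ t (k + 1) ∧ blockLength s t k ≤ s (k + 1)) :
    ∀ k < r, 2 ^ (2 * k + 1) ≤ blockLength s t (k + 1) := by
  intro k
  induction k with
  | zero =>
    intro hr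
    have h1 := hs 0 hr
    have h2 := (h 0 hr).1
    rw [blockLength_succ]
    omega
  | succ k ih =>
    intro hk
    have h1 := ih (by omega)
    -- The zeros and then the ones each at least double the length, hence a factor of four per pair.
    obtain ⟨h2, h3⟩ := h (k + 1) hk
    rw [blockLength_succ, show 2 * (k + 1) + 1 = 2 * k + 1 + 2 by ring, pow_add]
    omega

/-! ### Translation into the numerical conditions -/

theorem theorem3p1 (n r : ℕ) (hr : 1 ≤ r) (s t : ℕ → ℕ)
    (hs : ∀ i ∈ Finset.Icc 1 r, 0 < s i) (ht : ∀ i ∈ Finset.Icc 1 r, 0 < t i)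
    (b : Fin n → Bool) (hb : List.ofFn b = blockSequence r s t) :
    IsSimplyStructured (thresholdGraph b) ↔
      (1 ≤ r ∧ (r : ℤ) ≤ ⌊((⌊Real.logb 2 (n : ℝ)⌋ : ℝ) + 1) / 2⌋) ∧
      (∀ i ∈ Finset.Icc 1 r,
        ⌈((n : ℝ) - ∑ j ∈ Finset.Icc (i + 1) r, ((s j : ℝ) + (t j : ℝ))) / 2⌉ ≤ (t i : ℤ) ∧
        (t i : ℤ) ≤
          (n : ℤ) - ∑ j ∈ Finset.Icc (i + 1) r, ((s j : ℤ) + (t j : ℤ)) - 2 ^ (2 * i - 2)) ∧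
      (∀ i ∈ Finset.Icc 2 r,
        ⌈((n : ℝ) - (t i : ℝ) - ∑ j ∈ Finset.Icc (i + 1) r, ((s j : ℝ) + (t j : ℝ))) / 2⌉
          ≤ (s i : ℤ) ∧
        (s i : ℤ) ≤
          (n : ℤ) - (t i : ℤ) - ∑ j ∈ Finset.Icc (i + 1) r, ((s j : ℤ) + (t j : ℤ))
            - 2 ^ (2 * i - 3)) ∧
      (s 1 : ℤ) = (n : ℤ) - (t 1 : ℤ) - ∑ j ∈ Finset.Icc 2 r, ((s j : ℤ) + (t j : ℤ)) := by
  have hs' : ∀ k < r, 0 < s (k + 1) := fun k hk => hs _ (Finset.mem_Icc.2 ⟨by omega, hk⟩)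
  have ht' : ∀ k < r, 0 < t (k + 1) := fun k hk => ht _ (Finset.mem_Icc.2 ⟨by omega, hk⟩)
  have hn : n = blockLength s t r := by
    rw [← length_blockSequence, ← hb, List.length_ofFn]
  have hbB : b = fun i : Fin n => (blockSequence r s t).getD i false := by
    funext i
    rw [← hb]
    simp
  have hlast : (blockSequence r s t).getD (n - 1) false = true := by
    obtain ⟨m, rfl⟩ : ∃ m, r = m + 1 := ⟨r - 1, by omega⟩
    have h1 := ht' m (by omega)
    have h2 := blockLength_succ s t m
    rw [blockSequence_getD (k := m) _ s t (by omega) (by omega) (by omega),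
      decide_eq_true (by omega)]
  have key : IsSimplyStructured (thresholdGraph b) ↔
      ∀ k < r, blockLength s t k + s (k + 1) ≤ t (k + 1) ∧ blockLength s t k ≤ s (k + 1) := by
    subst hbB
    rw [← runs_long_iff_blocks_long hs' ht', ← hn]
    exact isSimplyStructured_thresholdGraph_iff
      (B := fun i => (blockSequence r s t).getD i false) hlast
  have hZ : ∀ k < r, (n : ℤ) - ∑ j ∈ Finset.Icc (k + 1 + 1) r, ((s j : ℤ) + (t j : ℤ)) =
      blockLength s t k + s (k + 1) + t (k + 1) := by
    intro k hk
    have h1 := blockLength_add_sum_Icc s t (show k + 1 ≤ r by omega)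
    rw [← hn, blockLength_succ] at h1
    zify at h1
    linarith
  have hR : ∀ k < r, (n : ℝ) - ∑ j ∈ Finset.Icc (k + 1 + 1) r, ((s j : ℝ) + (t j : ℝ)) =
      ((blockLength s t k + s (k + 1) + t (k + 1) : ℕ) : ℝ) := by
    intro k hk
    have h1 := hZ k hk
    have h2 := congrArg (Int.cast : ℤ → ℝ) h1
    push_cast at h2 ⊢
    exact h2
  rw [key]
  constructor
  · intro h
    have hpow := two_pow_le_blockLength hs' h
    refine ⟨⟨hr, ?_⟩, ?_, ?_, ?_⟩
    · have h1 := hpow (r - 1) (by omega)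
      rw [Nat.sub_add_cancel hr, ← hn] at h1
      have h2 : ((2 * (r - 1) + 1 : ℕ) : ℤ) ≤ ⌊Real.logb 2 (n : ℝ)⌋ := by
        rw [Int.le_floor, Int.cast_natCast, Real.le_logb_iff_rpow_le (by norm_num)
          (by exact_mod_cast (Nat.two_pow_pos _).trans_le h1), Real.rpow_natCast]
        exact_mod_cast h1
      rw [Int.le_floor, le_div_iff₀ (by norm_num)]
      have h3 : (r : ℤ) * 2 ≤ ⌊Real.logb 2 (n : ℝ)⌋ + 1 := by omega
      exact_mod_cast h3
    · intro i hi
      obtain ⟨k, rfl⟩ : ∃ k, i = k + 1 := ⟨i - 1, by have := (Finset.mem_Icc.1 hi).1; omega⟩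
      have hk : k < r := (Finset.mem_Icc.1 hi).2
      obtain ⟨h1, h2⟩ := h k hk
      rw [hR k hk, hZ k hk, Int.ceil_le, div_le_iff₀ (by norm_num)]
      constructor
      · have h3 : blockLength s t k + s (k + 1) + t (k + 1) ≤ t (k + 1) * 2 := by omega
        exact_mod_cast h3
      -- For `k ≥ 1` the prefix has length at least `2 ^ (2 * k - 1)` and the zeros double it; for
      -- `k = 0` only `s 1 ≥ 1` is needed.
      · have h3 : 2 ^ (2 * (k + 1) - 2) ≤ blockLength s t k + s (k + 1) := by
          rcases Nat.eq_zero_or_pos k with rfl | hk0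
          · have := hs' 0 hk
            simp only [zero_add, mul_one, Nat.sub_self, pow_zero] at *
            omega
          · have h4 := hpow (k - 1) (by omega)
            rw [Nat.sub_add_cancel hk0] at h4
            rw [show 2 * (k + 1) - 2 = 2 * (k - 1) + 1 + 1 by omega, pow_succ]
            omega
        zify at h3
        linarith
    · intro i hi
      have hi2 := (Finset.mem_Icc.1 hi).1
      obtain ⟨k, rfl⟩ : ∃ k, i = k + 1 := ⟨i - 1, by omega⟩
      have hk : k < r := (Finset.mem_Icc.1 hi).2
      obtain ⟨h1, h2⟩ := h k hk
      rw [sub_right_comm, hR k hk, sub_right_comm (n : ℤ), hZ k hk, Int.ceil_le,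
        div_le_iff₀ (by norm_num)]
      constructor
      · have h3 : blockLength s t k + s (k + 1) + t (k + 1) ≤ s (k + 1) * 2 + t (k + 1) := by
          omega
        rw [sub_le_iff_le_add]
        exact_mod_cast h3
      · have h3 := hpow (k - 1) (by omega)
        rw [Nat.sub_add_cancel (by omega), show 2 * (k - 1) + 1 = 2 * (k + 1) - 3 by omega] at h3
        zify at h3
        linarith
    · have h1 := hZ 0 hr
      simp only [zero_add, blockLength, Finset.range_zero, Finset.sum_empty, Nat.cast_zero,
        Nat.reduceAdd] at h1
      linarith
  -- The ceiling bounds alone imply the block inequalities.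
  · rintro ⟨-, h2, h3, -⟩ k hk
    constructor
    · have h4 := (h2 (k + 1) (Finset.mem_Icc.2 ⟨by omega, hk⟩)).1
      rw [hR k hk, Int.ceil_le, div_le_iff₀ (by norm_num)] at h4
      have h5 : blockLength s t k + s (k + 1) + t (k + 1) ≤ t (k + 1) * 2 := by exact_mod_cast h4
      omega
    · rcases Nat.eq_zero_or_pos k with rfl | hk0
      · simp [blockLength]
      have h4 := (h3 (k + 1) (Finset.mem_Icc.2 ⟨by omega, hk⟩)).1
      rw [sub_right_comm, hR k hk, Int.ceil_le, div_le_iff₀ (by norm_num),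
        sub_le_iff_le_add] at h4
      have h5 : blockLength s t k + s (k + 1) + t (k + 1) ≤ s (k + 1) * 2 + t (k + 1) := by
        exact_mod_cast h4
      omega
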